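/- **Theorem 2.** Let $U\subseteq\mathbb R^4$ be open and let $e_0=u,e_1,e_2,e_3$ be smooth vector fields on $U$ that form a basis at each point. Let $g$ be the Lorentzian metric for which they are orthonormal, $g_{ab}=\mathrm{diag}(-1,1,1,1)$; let $[e_a,e_b]=\gamma^c{}_{ab}e_c$, let $\nabla$ be the Levi-Civita connection of $g$, with curvature $R^a{}_{bcd}$, Ricci tensor $R_{bd}=R^c{}_{bcd}$ and scalar curvature $R$. All indices refer to the tetrad, $a,b,\dots$ running over $0,\dots,3$ and $\alpha,\beta,\dots$ over $1,2,3$; $h_{ab}=g_{ab}+u_au_b$, $\eta_{abcd}$ is totally antisymmetric with $\eta_{0123}=-1$, and $\varepsilon_{abc}=\eta_{abcd}u^d$. Let $\rho,p$ be smooth functions, $q_a$ a smooth vector field orthogonal to $u$, and $\pi_{ab},E_{ab},H_{ab}$ smooth symmetric trace-free tensor fields orthogonal to $u$, on $U$. Put $$T_{ab}=\rho u_au_b+p h_{ab}+2q_{(a}u_{b)}+\pi_{ab},\qquad T=T^a{}_a,$$ $$C_{ab}{}^{cd}=4\bigl(u_{[a}u^{[c}+h_{[a}{}^{[c}\bigr)E_{b]}{}^{d]}+2\varepsilon_{abe}u^{[c}H^{d]e}+2\varepsilon^{cde}u_{[a}H_{b]e},$$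 $$K_{abcd}=C_{abcd}+\bigl(g_{a[c}S_{d]b}+g_{b[d}S_{c]a}\bigr)+\tfrac13 T\,g_{a[c}g_{d]b},\qquad S_{ab}=T_{ab}-\tfrac12Tg_{ab}.$$ The *Jacobi-Ricci-Bianchi (JRB) system* consists of the Jacobi equations $e_{[a}\gamma^d{}_{bc]}-\gamma^d{}_{e[a}\gamma^e{}_{bc]}=0$, the Ricci equations for $u$, $u^a{}_{;c;d}-u^a{}_{;d;c}=K^a{}_{0dc}$, and the second Bianchi equations $K^a{}_{b[cd;e]}=0$. Put $\mathcal I_{\alpha\beta}=E_{\alpha\beta}-\tfrac12\pi_{\alpha\beta}$, $\mathcal J_{\alpha\beta}=H_{\alpha\beta}-\tfrac12\eta_{\alpha\beta cd}q^cu^d$ and $\mathcal Y_{\alpha\beta}=T_{\alpha\beta}-(R_{\alpha\beta}-\tfrac12Rg_{\alpha\beta})$. Call a point $x\in U$ *generic* if at $x$ 1. $[\mathcal I,H]=0$; 2. $\mathcal I$ is non-degenerate, i.e. has three distinct eigenvalues; 3. $q$ is not parallel to an eigenblade of $H$, where an eigenblade of a matrix is an invariant line or plane through $0$ and only those eigenblades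 of $H$ matter that are also eigenblades of $\mathcal I$; in other words, $q_1q_2q_3\ne0$ in a common eigenframe of $\mathcal I$ and $H$. Then: (a) If the JRB system holds on $U$, then the Einstein field equations $R_{ab}-\tfrac12Rg_{ab}=T_{ab}$ hold (all ten of them) at every generic point. (b) If the JRB system holds on $U$, then at every point of $U$ the $\mathcal Y_{\alpha\beta}$ satisfy the homogeneous linear system (the integrability conditions of the second Bianchi equations) $$\begin{pmatrix}-\mathcal I_{23}&0&\mathcal I_{23}\\ \mathcal I_{31}&-\mathcal I_{31}&0\\ 0&\mathcal I_{12}&-\mathcal I_{12}\end{pmatrix}\begin{pmatrix}\mathcal Y_{33}\\ \mathcal Y_{11}\\ \mathcal Y_{22}\end{pmatrix}=\begin{pmatrix}-\mathcal I_{31}&\mathcal I_{22}-\mathcal I_{33}&\mathcal I_{12}\\ \mathcal I_{23}&-\mathcal I_{12}&\mathcal I_{33}-\mathcal I_{11}\\ \mathcal I_{11}-\mathcal I_{22}&\mathcal I_{31}&-\mathcal I_{23}\end{pmatrix}\begin{pmatrix}\mathcal Y_{12}\\ \mathcal Y_{23}\\ \mathcal Y_{31}\end{pmatrix},$$ $$\begin{pmatrix}0&-\mathcal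 J_{21}&\mathcal J_{12}\\ -\mathcal J_{13}&\mathcal J_{31}&0\\ \mathcal J_{23}&0&-\mathcal J_{32}\end{pmatrix}\begin{pmatrix}\mathcal Y_{33}\\ \mathcal Y_{11}\\ \mathcal Y_{22}\end{pmatrix}=\begin{pmatrix}\mathcal J_{22}-\mathcal J_{11}&-\mathcal J_{13}&\mathcal J_{23}\\ -\mathcal J_{32}&\mathcal J_{12}&\mathcal J_{11}-\mathcal J_{33}\\ \mathcal J_{31}&\mathcal J_{33}-\mathcal J_{22}&-\mathcal J_{21}\end{pmatrix}\begin{pmatrix}\mathcal Y_{12}\\ \mathcal Y_{23}\\ \mathcal Y_{31}\end{pmatrix}.$$ (c) At every generic point at which the Jacobi and Ricci equations hold, this linear system is equivalent to the Einstein field equations. -/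

import Mathlib

open scoped ContDiff Matrix

noncomputable section

namespace JRB

/-- Points of a coordinate patch of space-time. -/
abbrev Pt : Type := Fin 4 → ℝ

/-- Tetrad components `g_ab = diag(-1, 1, 1, 1)` of the metric in an orthonormal tetrad.
They coincide with the components of the inverse metric. -/
def g (a b : Fin 4) : ℝ := (Matrix.diagonal ![-1, 1, 1, 1] : Matrix (Fin 4) (Fin 4) ℝ) a b

/-- Contravariant components `u^a` of the timelike unit vector `u = e_0`. -/
def uUp (a : Fin 4) : ℝ := if a = 0 then 1 else 0

/-- Covariant components `u_a`. -/
def uLow (a : Fin 4) : ℝ := ∑ b, g a b * uUp b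

/-- The projector `h_ab = g_ab + u_a u_b`. -/
def h (a b : Fin 4) : ℝ := g a b + uLow a * uLow b

/-- The Levi-Civita tensor `η_abcd` in the tetrad, normalised by `η_0123 = -1`. -/
def eta (a b c d : Fin 4) : ℝ :=
  -((Matrix.of fun i j : Fin 4 => if ![a, b, c, d] i = j then (1 : ℤ) else 0).det : ℝ)

/-- `ε_abc = η_abcd u^d`. -/
def eps (a b c : Fin 4) : ℝ := ∑ d, eta a b c d * uUp d

/-- A spatial vector regarded as a four-vector orthogonal to `u`. -/
def extVec (v : Fin 3 → ℝ) (a : Fin 4) : ℝ := Fin.cases 0 v a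

/-- A spatial 2-tensor regarded as a space-time tensor orthogonal to `u`. -/
def extMat (M : Matrix (Fin 3) (Fin 3) ℝ) (a b : Fin 4) : ℝ :=
  Fin.cases 0 (fun α => Fin.cases 0 (fun β => M α β) b) a

/-- The unknowns: an orthonormal tetrad `e_a` (with `e_0 = u`), its commutation coefficients
`γ^c_ab` (written `γ c a b`), and the spatial tensors and scalars out of which the energy-momentum
tensor and the Weyl part of the curvature are built. The index `α : Fin 3` is the spatial tetrad
index `α + 1`. -/
structure Fields where
  e : Fin 4 → Pt → Pt
  γ : Fin 4 → Fin 4 → Fin 4 → Pt → ℝ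
  /-- electric Weyl part -/
  E : Pt → Matrix (Fin 3) (Fin 3) ℝ
  /-- magnetic Weyl part -/
  H : Pt → Matrix (Fin 3) (Fin 3) ℝ
  /-- anisotropic pressure -/
  aniso : Pt → Matrix (Fin 3) (Fin 3) ℝ
  /-- energy flux -/
  q : Pt → Fin 3 → ℝ
  /-- energy density -/
  ρ : Pt → ℝ
  /-- isotropic pressure -/
  p : Pt → ℝ

namespace Fields

variable (S : Fields)

/-- On `U` all fields are smooth, the `e_a` form a basis at each point and satisfy
`[e_a, e_b] = γ^c_ab e_c`, and `E`, `H`, `aniso` are symmetric and trace-free. -/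
structure IsRegularOn (U : Set Pt) : Prop where
  smooth_e : ∀ a, ContDiffOn ℝ ∞ (S.e a) U
  linInd : ∀ x ∈ U, LinearIndependent ℝ (fun a => S.e a x)
  commutators : ∀ x ∈ U, ∀ a b,
    VectorField.lieBracket ℝ (S.e a) (S.e b) x = ∑ c, S.γ c a b x • S.e c x
  smooth_γ : ∀ c a b, ContDiffOn ℝ ∞ (S.γ c a b) U
  smooth_E : ∀ α β, ContDiffOn ℝ ∞ (fun x => S.E x α β) U
  smooth_H : ∀ α β, ContDiffOn ℝ ∞ (fun x => S.H x α β) U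
  smooth_aniso : ∀ α β, ContDiffOn ℝ ∞ (fun x => S.aniso x α β) U
  smooth_q : ∀ α, ContDiffOn ℝ ∞ (fun x => S.q x α) U
  smooth_ρ : ContDiffOn ℝ ∞ S.ρ U
  smooth_p : ContDiffOn ℝ ∞ S.p U
  symm_E : ∀ x ∈ U, (S.E x).IsSymm
  symm_H : ∀ x ∈ U, (S.H x).IsSymm
  symm_aniso : ∀ x ∈ U, (S.aniso x).IsSymm
  trace_E : ∀ x ∈ U, (S.E x).trace = 0
  trace_H : ∀ x ∈ U, (S.H x).trace = 0
  trace_aniso : ∀ x ∈ U, (S.aniso x).trace = 0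

/-- Directional derivative `∂_a f` along `e_a`. -/
def dd (a : Fin 4) (f : Pt → ℝ) (x : Pt) : ℝ := fderiv ℝ f x (S.e a x)

/-! ### The Levi-Civita connection of the tetrad and its curvature -/

/-- `γ_cab = g_cd γ^d_ab`. -/
def γLow (c a b : Fin 4) (x : Pt) : ℝ := ∑ d, g c d * S.γ d a b x

/-- `Γ_cab = ½ (γ_bca + γ_acb - γ_cab)`. -/
def ΓLow (c a b : Fin 4) (x : Pt) : ℝ :=
  (1 / 2) * (S.γLow b c a x + S.γLow a c b x - S.γLow c a b x)

/-- `Γ^c_ab`, where `∇_{e_b} e_a = Γ^c_ab e_c`. -/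
def Γ (c a b : Fin 4) (x : Pt) : ℝ := ∑ d, g c d * S.ΓLow d a b x

/-- The curvature `R^a_bcd` of the Levi-Civita connection. -/
def riemann (a b c d : Fin 4) (x : Pt) : ℝ :=
  S.dd c (S.Γ a b d) x - S.dd d (S.Γ a b c) x
    + ∑ f, (S.Γ f b d x * S.Γ a f c x - S.Γ f b c x * S.Γ a f d x - S.γ f c d x * S.Γ a b f x)

/-- The Ricci tensor `R_bd = R^c_bcd`. -/
def ricci (b d : Fin 4) (x : Pt) : ℝ := ∑ c, S.riemann c b c d x

/-- The scalar curvature. -/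
def scalar (x : Pt) : ℝ := ∑ a, ∑ b, g a b * S.ricci a b x

/-- The Einstein tensor `R_ab - ½ R g_ab`. -/
def einstein (a b : Fin 4) (x : Pt) : ℝ := S.ricci a b x - (1 / 2) * S.scalar x * g a b

/-! ### Energy-momentum tensor and the curvature built from the field variables -/

/-- `T_ab = ρ u_a u_b + p h_ab + 2 q_(a u_b) + π_ab`. -/
def T (a b : Fin 4) (x : Pt) : ℝ :=
  S.ρ x * uLow a * uLow b + S.p x * h a b
    + (extVec (S.q x) a * uLow b + extVec (S.q x) b * uLow a) + extMat (S.aniso x) a b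

/-- The trace of the energy-momentum tensor. -/
def trT (x : Pt) : ℝ := ∑ a, ∑ b, g a b * S.T a b x

/-- The Weyl-type tensor with electric part `E` and magnetic part `H`:
`4 (u_[a u_[c + h_[a[c) E_b]d] + 2 ε_abe u_[c H_d]^e + 2 ε_cde u_[a H_b]^e`. -/
def weyl (a b c d : Fin 4) (x : Pt) : ℝ :=
  ((uLow a * uLow c + h a c) * extMat (S.E x) b d
      - (uLow b * uLow c + h b c) * extMat (S.E x) a d
      - (uLow a * uLow d + h a d) * extMat (S.E x) b c
      + (uLow b * uLow d + h b d) * extMat (S.E x) a c)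
    + ∑ f, eps a b f * (uLow c * extMat (S.H x) d f - uLow d * extMat (S.H x) c f)
    + ∑ f, eps c d f * (uLow a * extMat (S.H x) b f - uLow b * extMat (S.H x) a f)

/-- The Ricci-type tensor `T_ab - ½ T g_ab`. -/
def ric (a b : Fin 4) (x : Pt) : ℝ := S.T a b x - (1 / 2) * S.trT x * g a b

/-- The curvature variable `K_abcd`, i.e. the Riemann tensor as expressed through
`E, H, q, π, ρ, p`:
`C_abcd + g_a[c R_d]b + g_b[d R_c]a - ⅓ R g_a[c g_d]b` with `R_ab = T_ab - ½ T g_ab`,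
`R = -T`. -/
def K (a b c d : Fin 4) (x : Pt) : ℝ :=
  S.weyl a b c d x
    + (1 / 2) * (g a c * S.ric d b x - g a d * S.ric c b x)
    + (1 / 2) * (g b d * S.ric c a x - g b c * S.ric d a x)
    - (1 / 3) * (-S.trT x) * ((1 / 2) * (g a c * g d b - g a d * g c b))

/-- `K^a_bcd`. -/
def KUp (a b c d : Fin 4) (x : Pt) : ℝ := ∑ f, g a f * S.K f b c d x

/-! ### Covariant derivatives in the tetrad -/

/-- `w^a_;c`. -/
def covVec (w : Fin 4 → Pt → ℝ) (a c : Fin 4) (x : Pt) : ℝ :=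
  S.dd c (w a) x + ∑ f, S.Γ a f c x * w f x

/-- `w^a_;c;d`. -/
def covVec2 (w : Fin 4 → Pt → ℝ) (a c d : Fin 4) (x : Pt) : ℝ :=
  S.dd d (S.covVec w a c) x
    + ∑ f, (S.Γ a f d x * S.covVec w f c x - S.Γ f c d x * S.covVec w a f x)

/-- `K^a_bcd;e` -/
def covK (a b c d e : Fin 4) (x : Pt) : ℝ :=
  S.dd e (S.KUp a b c d) x
    + ∑ f, (S.Γ a f e x * S.KUp f b c d x - S.Γ f b e x * S.KUp a f c d x
        - S.Γ f c e x * S.KUp a b f d x - S.Γ f d e x * S.KUp a b c f x)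

/-! ### The Jacobi-Ricci-Bianchi system and the field equations -/

/-- Jacobi equations `∂_[a γ^d_bc] - γ^d_f[a γ^f_bc] = 0`
(`γ^d_bc` being antisymmetric in `bc`). -/
def Jacobi (x : Pt) : Prop :=
  ∀ a b c d : Fin 4,
    (S.dd a (S.γ d b c) x + S.dd b (S.γ d c a) x + S.dd c (S.γ d a b) x)
      - ∑ f, (S.γ d f a x * S.γ f b c x + S.γ d f b x * S.γ f c a x
          + S.γ d f c x * S.γ f a b x) = 0

/-- Ricci equations for `u`: `u^a_;c;d - u^a_;d;c = K^a_0dc`. -/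
def RicciU (x : Pt) : Prop :=
  ∀ a c d : Fin 4,
    S.covVec2 (fun b _ => uUp b) a c d x - S.covVec2 (fun b _ => uUp b) a d c x
      = S.KUp a 0 d c x

/-- Second Bianchi equations `K^a_b[cd;e] = 0` (`K^a_bcd` being antisymmetric in `cd`). -/
def Bianchi (x : Pt) : Prop :=
  ∀ a b c d e : Fin 4, S.covK a b c d e x + S.covK a b d e c x + S.covK a b e c d x = 0

/-- The Jacobi-Ricci-Bianchi system on `U`. -/
def IsJRBSolutionOn (U : Set Pt) : Prop :=
  ∀ x ∈ U, S.Jacobi x ∧ S.RicciU x ∧ S.Bianchi x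

/-- The Einstein field equations `R_ab - ½ R g_ab = T_ab` at `x`. -/
def EFE (x : Pt) : Prop := ∀ a b : Fin 4, S.einstein a b x = S.T a b x

/-- `𝓘_αβ = E_αβ - ½ π_αβ`. -/
def I (x : Pt) : Matrix (Fin 3) (Fin 3) ℝ := S.E x - (1 / 2 : ℝ) • S.aniso x

/-- `𝓙_αβ = H_αβ - ½ η_αβcd q^c u^d`. -/
def J (x : Pt) : Matrix (Fin 3) (Fin 3) ℝ := Matrix.of fun α β =>
  S.H x α β - (1 / 2) * ∑ c, ∑ d, eta α.succ β.succ c d * extVec (S.q x) c * uUp d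

/-- The deviation `𝓨_αβ` from the spatial field equations, `T_αβ - (R_αβ - ½ R g_αβ)`. -/
def Y (x : Pt) : Matrix (Fin 3) (Fin 3) ℝ := Matrix.of fun α β =>
  S.T α.succ β.succ x - S.einstein α.succ β.succ x

/-- The homogeneous linear system for the `𝓨_αβ`. -/
def YSystem (x : Pt) : Prop :=
  let I := S.I x
  let J := S.J x
  let Y := S.Y x
  !![-I 1 2, 0, I 1 2;
     I 2 0, -I 2 0, 0;
     0, I 0 1, -I 0 1] *ᵥ ![Y 2 2, Y 0 0, Y 1 1]
    = !![-I 2 0, I 1 1 - I 2 2, I 0 1;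
         I 1 2, -I 0 1, I 2 2 - I 0 0;
         I 0 0 - I 1 1, I 2 0, -I 1 2] *ᵥ ![Y 0 1, Y 1 2, Y 2 0] ∧
  !![0, -J 1 0, J 0 1;
     -J 0 2, J 2 0, 0;
     J 1 2, 0, -J 2 1] *ᵥ ![Y 2 2, Y 0 0, Y 1 1]
    = !![J 1 1 - J 0 0, -J 0 2, J 1 2;
         -J 2 1, J 0 1, J 0 0 - J 2 2;
         J 2 0, J 2 2 - J 1 1, -J 1 0] *ᵥ ![Y 0 1, Y 1 2, Y 2 0]

end Fields

/-- Non-degeneracy in the sense of distinct eigenvalues: every eigenspace is at most a line. -/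
def NonDegenerate (M : Matrix (Fin 3) (Fin 3) ℝ) : Prop :=
  ∀ μ : ℝ, Module.finrank ℝ (Module.End.eigenspace (Matrix.toLin' M) μ) ≤ 1

/-- An eigenblade of `M`, given by the subspace it spans: a line or a plane mapped into itself. -/
def IsEigenblade (M : Matrix (Fin 3) (Fin 3) ℝ) (P : Submodule ℝ (Fin 3 → ℝ)) : Prop :=
  P ≠ ⊥ ∧ P ≠ ⊤ ∧ ∀ v ∈ P, M *ᵥ v ∈ P

/-- The genericity conditions at `x`: `𝓘` and `H` commute, `𝓘` is non-degenerate, and `q` is not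
parallel to an eigenblade of `H`. Only the eigenblades of `H` that are adapted to a common
eigenframe of `𝓘` and `H`, i.e. that are eigenblades of `𝓘` too, have to be avoided
(all of them when `H` has distinct eigenvalues). -/
structure Generic (S : Fields) (x : Pt) : Prop where
  commute : Commute (S.I x) (S.H x)
  nonDegenerate : NonDegenerate (S.I x)
  not_parallel : ∀ P, IsEigenblade (S.H x) P → IsEigenblade (S.I x) P → S.q x ∉ P

end JRB

end

noncomputable section

namespace JRB

/-! Everything is expressed through the deviation `dev` = K - R of the curvature variable from the
true curvature.

The Jacobi equations give R the first Bianchi identity, hence the pair symmetry, which K has by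
construction. The Ricci equations for u say that the deviation vanishes when its second index is 0,
and the symmetries extend this to every position of the 0. What remains is a symmetric form on
spatial bivectors, six numbers. Since the Ricci contraction of K is T_ab - ½ T g_ab (`K_trace`), the
deviation from the field equations is the Einstein tensor of `dev`; its spatial part Y is, up to
sign, the double dual of those six numbers (`Y_eq`). Hence Y = 0 already forces all ten field
equations.

For the linear system, K is read as a matrix-valued two-form and Γ as a matrix-valued one-form G.
The second Bianchi equations say dK + G∧K - K∧G = 0. Applying d, with d² = 0 by Jacobi, gives R∧K -
K∧R = 0 (`commutator_riemannMat_KMat`). Two-forms commute under the wedge product, so K∧K drops out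
of this commutator and R may be replaced by the deviation (`commutator_devMat_KMat`). The deviation
consists of spatial rotations and has only spatial form indices, so only the K_0γ occur: their boost
part is I up to a multiple of the identity, their rotation part is J. The boost and rotation entries
of the commutator are the two blocks of the system.

The first block says [I, Y] = 0. The second is [H, Y] = 0 with an additional term (tr Y - Y)q, as J
is H plus an antisymmetric part dual to q. If I has simple spectrum and commutes with H, then Y
commutes with H as well, so (tr Y - Y)q = 0. The kernel of tr Y - Y is invariant under I and H and
contains q; by genericity it is the whole space, so Y = (tr Y)·1 and therefore Y = 0. -/

theorem g_of_ne {a b : Fin 4} (hab : a ≠ b) : g a b = 0 := by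
  simp [g, hab]

theorem g_mul_self (a : Fin 4) : g a a * g a a = 1 := by
  fin_cases a <;> simp [g]

theorem g_comm (a b : Fin 4) : g a b = g b a := by
  by_cases hab : a = b
  · rw [hab]
  · rw [g_of_ne hab, g_of_ne (Ne.symm hab)]

theorem sum_g_mul (a : Fin 4) (f : Fin 4 → ℝ) : ∑ b, g a b * f b = g a a * f a :=
  Finset.sum_eq_single a (fun b _ hb => by rw [g_of_ne (Ne.symm hb), zero_mul]) (by simp)

theorem sum_sum_g_mul (f : Fin 4 → Fin 4 → ℝ) :
    ∑ a, ∑ b, g a b * f a b = ∑ a, g a a * f a a :=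
  Finset.sum_congr rfl fun a _ => sum_g_mul a (f a)

namespace Fields

variable {S : Fields} {U : Set Pt} {x : Pt}

/-! ### Directional derivatives -/

theorem dd_congr {f f' : Pt → ℝ} (a : Fin 4) (hf : f =ᶠ[nhds x] f') :
    S.dd a f x = S.dd a f' x := by
  rw [dd, dd, hf.fderiv_eq]

theorem dd_const (a : Fin 4) (c : ℝ) : S.dd a (fun _ => c) x = 0 := by
  simp [dd]

theorem dd_add {f f' : Pt → ℝ} (a : Fin 4) (hf : DifferentiableAt ℝ f x)
    (hf' : DifferentiableAt ℝ f' x) :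
    S.dd a (fun y => f y + f' y) x = S.dd a f x + S.dd a f' x := by
  simp [dd, fderiv_fun_add hf hf']

theorem dd_sub {f f' : Pt → ℝ} (a : Fin 4) (hf : DifferentiableAt ℝ f x)
    (hf' : DifferentiableAt ℝ f' x) :
    S.dd a (fun y => f y - f' y) x = S.dd a f x - S.dd a f' x := by
  simp [dd, fderiv_fun_sub hf hf']

theorem dd_neg {f : Pt → ℝ} (a : Fin 4) : S.dd a (fun y => -f y) x = -S.dd a f x := by
  simp [dd, fderiv_fun_neg]

theorem dd_mul {f f' : Pt → ℝ} (a : Fin 4) (hf : DifferentiableAt ℝ f x)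
    (hf' : DifferentiableAt ℝ f' x) :
    S.dd a (fun y => f y * f' y) x = S.dd a f x * f' x + f x * S.dd a f' x := by
  simp [dd, fderiv_fun_mul hf hf']
  ring

theorem dd_const_mul {f : Pt → ℝ} (a : Fin 4) (c : ℝ) (hf : DifferentiableAt ℝ f x) :
    S.dd a (fun y => c * f y) x = c * S.dd a f x := by
  simp [dd, fderiv_const_mul hf]

theorem dd_sum {ι : Type*} {f : ι → Pt → ℝ} (s : Finset ι) (a : Fin 4)
    (hf : ∀ i ∈ s, DifferentiableAt ℝ (f i) x) :
    S.dd a (fun y => ∑ i ∈ s, f i y) x = ∑ i ∈ s, S.dd a (f i) x := by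
  simp [dd, fderiv_fun_sum hf]

/-! ### Smoothness and commutators -/

theorem IsRegularOn.contDiffAt_e (hS : S.IsRegularOn U) (hU : IsOpen U) (hx : x ∈ U) (a : Fin 4) :
    ContDiffAt ℝ ∞ (S.e a) x :=
  (hS.smooth_e a).contDiffAt (hU.mem_nhds hx)

theorem IsRegularOn.contDiffAt_γ (hS : S.IsRegularOn U) (hU : IsOpen U) (hx : x ∈ U)
    (c a b : Fin 4) : ContDiffAt ℝ ∞ (S.γ c a b) x :=
  (hS.smooth_γ c a b).contDiffAt (hU.mem_nhds hx)

theorem differentiableAt_of_contDiffAt {f : Pt → ℝ} (hf : ContDiffAt ℝ ∞ f x) :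
    DifferentiableAt ℝ f x :=
  hf.differentiableAt (by simp)

theorem contDiffAt_dd {f : Pt → ℝ} {a : Fin 4} (he : ContDiffAt ℝ ∞ (S.e a) x)
    (hf : ContDiffAt ℝ ∞ f x) : ContDiffAt ℝ ∞ (S.dd a f) x :=
  (hf.fderiv_right (m := ∞) (by simp)).clm_apply he

theorem IsRegularOn.dd_dd_sub (hS : S.IsRegularOn U) (hU : IsOpen U) (hx : x ∈ U) {f : Pt → ℝ}
    (hf : ContDiffAt ℝ ∞ f x) (a b : Fin 4) :
    S.dd a (S.dd b f) x - S.dd b (S.dd a f) x = ∑ c, S.γ c a b x * S.dd c f x := by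
  have hlie := VectorField.fderiv_apply_lieBracket (𝕜 := ℝ) (V := S.e a) (W := S.e b) hf
    (by
      rw [minSmoothness_of_isRCLikeNormedField]
      exact WithTop.coe_le_coe.2 (le_top : (2 : ℕ∞) ≤ ⊤))
    ((hS.contDiffAt_e hU hx b).differentiableAt (by simp))
    ((hS.contDiffAt_e hU hx a).differentiableAt (by simp))
  rw [hS.commutators x hx a b] at hlie
  simp only [map_sum, map_smul, smul_eq_mul] at hlie
  exact hlie.symm

theorem IsRegularOn.γ_antisymm (hS : S.IsRegularOn U) (hx : x ∈ U) (c a b : Fin 4) :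
    S.γ c a b x = -S.γ c b a x := by
  have hsum : ∑ c, (S.γ c a b x + S.γ c b a x) • S.e c x = 0 := by
    simp only [add_smul, Finset.sum_add_distrib]
    rw [← hS.commutators x hx a b, ← hS.commutators x hx b a, VectorField.lieBracket_swap]
    simp
  linarith [Fintype.linearIndependent_iff.mp (hS.linInd x hx) _ hsum c]

theorem IsRegularOn.dd_γ_antisymm (hS : S.IsRegularOn U) (hU : IsOpen U) (hx : x ∈ U)
    (f c a b : Fin 4) : S.dd f (S.γ c a b) x = -S.dd f (S.γ c b a) x := by
  rw [← dd_neg]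
  exact dd_congr f (Filter.eventually_of_mem (hU.mem_nhds hx) fun y hy => hS.γ_antisymm hy c a b)

/-! ### The connection -/

theorem γLow_eq (c a b : Fin 4) (x : Pt) : S.γLow c a b x = g c c * S.γ c a b x :=
  sum_g_mul c fun d => S.γ d a b x

theorem Γ_eq (c a b : Fin 4) (x : Pt) : S.Γ c a b x = g c c * S.ΓLow c a b x :=
  sum_g_mul c fun d => S.ΓLow d a b x

theorem IsRegularOn.contDiffAt_Γ (hS : S.IsRegularOn U) (hU : IsOpen U) (hx : x ∈ U)
    (c a b : Fin 4) : ContDiffAt ℝ ∞ (S.Γ c a b) x := by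
  have hγ := fun c a b => hS.contDiffAt_γ hU hx c a b
  unfold Γ ΓLow γLow
  fun_prop

theorem IsRegularOn.Γ_sub (hS : S.IsRegularOn U) (hx : x ∈ U) (c a b : Fin 4) :
    S.Γ c b a x - S.Γ c a b x = S.γ c a b x := by
  simp only [Γ_eq, ΓLow, γLow_eq]
  rw [hS.γ_antisymm hx c b a]
  linear_combination S.γ c a b x * g_mul_self c

theorem IsRegularOn.g_mul_Γ (hS : S.IsRegularOn U) (hx : x ∈ U) (a b c : Fin 4) :
    g a a * S.Γ a b c x = -(g b b * S.Γ b a c x) := by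
  simp only [Γ_eq, ΓLow, γLow_eq, ← mul_assoc, g_mul_self]
  rw [hS.γ_antisymm hx c a b]
  ring

theorem IsRegularOn.dd_Γ_sub (hS : S.IsRegularOn U) (hU : IsOpen U) (hx : x ∈ U)
    (f c a b : Fin 4) :
    S.dd f (S.Γ c b a) x - S.dd f (S.Γ c a b) x = S.dd f (S.γ c a b) x := by
  rw [← dd_sub f (differentiableAt_of_contDiffAt (hS.contDiffAt_Γ hU hx c b a))
    (differentiableAt_of_contDiffAt (hS.contDiffAt_Γ hU hx c a b))]
  exact dd_congr f (Filter.eventually_of_mem (hU.mem_nhds hx) fun y hy => hS.Γ_sub hy c a b)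

theorem IsRegularOn.g_mul_dd_Γ (hS : S.IsRegularOn U) (hU : IsOpen U) (hx : x ∈ U)
    (f a b c : Fin 4) :
    g a a * S.dd f (S.Γ a b c) x = -(g b b * S.dd f (S.Γ b a c) x) := by
  rw [← dd_const_mul f _ (differentiableAt_of_contDiffAt (hS.contDiffAt_Γ hU hx a b c)),
    ← dd_const_mul f _ (differentiableAt_of_contDiffAt (hS.contDiffAt_Γ hU hx b a c)), ← dd_neg]
  exact dd_congr f (Filter.eventually_of_mem (hU.mem_nhds hx) fun y hy => hS.g_mul_Γ hy a b c)

/-! ### Symmetries of the curvature -/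

theorem IsRegularOn.riemann_antisymm (hS : S.IsRegularOn U) (hx : x ∈ U) (a b c d : Fin 4) :
    S.riemann a b c d x = -S.riemann a b d c x := by
  simp only [riemann, neg_add, neg_sub, ← Finset.sum_neg_distrib]
  congr 1
  refine Finset.sum_congr rfl fun f _ => ?_
  rw [hS.γ_antisymm hx f c d]
  ring

/-- Metric compatibility: the connection matrices lie in the Lorentz algebra, so the curvature
matrices do too. -/
theorem IsRegularOn.g_mul_riemann (hS : S.IsRegularOn U) (hU : IsOpen U) (hx : x ∈ U)
    (a b c d : Fin 4) :
    g a a * S.riemann a b c d x = -(g b b * S.riemann b a c d x) := by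
  have hsum : g a a * ∑ f, (S.Γ f b d x * S.Γ a f c x - S.Γ f b c x * S.Γ a f d x
        - S.γ f c d x * S.Γ a b f x)
      = -(g b b * ∑ f, (S.Γ f a d x * S.Γ b f c x - S.Γ f a c x * S.Γ b f d x
        - S.γ f c d x * S.Γ b a f x)) := by
    simp only [Finset.mul_sum, ← Finset.sum_neg_distrib]
    refine Finset.sum_congr rfl fun f _ => ?_
    linear_combination S.Γ f b d x * hS.g_mul_Γ hx a f c - S.Γ f b c x * hS.g_mul_Γ hx a f d
      - S.γ f c d x * hS.g_mul_Γ hx a b f - S.Γ f a c x * hS.g_mul_Γ hx f b d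
      + S.Γ f a d x * hS.g_mul_Γ hx f b c
  simp only [riemann]
  linear_combination hsum + hS.g_mul_dd_Γ hU hx c a b d - hS.g_mul_dd_Γ hU hx d a b c

/-- Vanishing torsion turns differences of Γ, and of their derivatives, into γ; the cyclic sum then
becomes the Jacobi equation. -/
theorem IsRegularOn.riemann_cyclic (hS : S.IsRegularOn U) (hU : IsOpen U) (hx : x ∈ U)
    (hJ : S.Jacobi x) (a b c d : Fin 4) :
    S.riemann a b c d x + S.riemann a c d b x + S.riemann a d b c x = 0 := by
  have hsum : ∑ f, (S.Γ f b d x * S.Γ a f c x - S.Γ f b c x * S.Γ a f d x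
        - S.γ f c d x * S.Γ a b f x)
      + ∑ f, (S.Γ f c b x * S.Γ a f d x - S.Γ f c d x * S.Γ a f b x
        - S.γ f d b x * S.Γ a c f x)
      + ∑ f, (S.Γ f d c x * S.Γ a f b x - S.Γ f d b x * S.Γ a f c x
        - S.γ f b c x * S.Γ a d f x)
      = - ∑ f, (S.γ a f b x * S.γ f c d x + S.γ a f c x * S.γ f d b x
          + S.γ a f d x * S.γ f b c x) := by
    simp only [← Finset.sum_add_distrib, ← Finset.sum_neg_distrib]
    refine Finset.sum_congr rfl fun f _ => ?_
    rw [← hS.Γ_sub hx f c d, ← hS.Γ_sub hx f d b, ← hS.Γ_sub hx f b c, ← hS.Γ_sub hx a f b,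
      ← hS.Γ_sub hx a f c, ← hS.Γ_sub hx a f d]
    ring
  simp only [riemann]
  linear_combination hsum + hJ b c d a + hS.dd_Γ_sub hU hx c a d b + hS.dd_Γ_sub hU hx d a b c
    + hS.dd_Γ_sub hU hx b a c d

/-- The classical argument: the four cyclic identities, one for each choice of the leading index,
are combined using antisymmetry within both index pairs. -/
theorem IsRegularOn.riemann_pair_symm (hS : S.IsRegularOn U) (hU : IsOpen U) (hx : x ∈ U)
    (hJ : S.Jacobi x) (a b c d : Fin 4) :
    g a a * S.riemann a b c d x = g c c * S.riemann c d a b x := by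
  have hcyc := fun a b c d => congrArg (g a a * ·) (hS.riemann_cyclic hU hx hJ a b c d)
  simp only [mul_add, mul_zero] at hcyc
  have hR := fun a b c d => hS.g_mul_riemann hU hx a b c d
  have hR' := fun a b c d => congrArg (g a a * ·) (hS.riemann_antisymm hx a b c d)
  simp only [mul_neg] at hR'
  linarith [hcyc a b c d, hcyc b c d a, hcyc c d a b, hcyc d a b c,
    hR a b c d, hR a c d b, hR a d b c, hR b c d a, hR b d a c, hR c d a b,
    hR' a b c d, hR' a c d b, hR' a d b c, hR' b c d a, hR' b d a c, hR' c d a b,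
    hR' b a c d, hR' c a d b, hR' d a b c, hR' c b d a, hR' d b a c, hR' d c a b]

/-- The Ricci equations for `u` prescribe the components `R^a_0cd` of the curvature. -/
theorem IsRegularOn.riemann_zero (hS : S.IsRegularOn U) (hx : x ∈ U) (hR : S.RicciU x)
    (a c d : Fin 4) : S.riemann a 0 c d x = S.KUp a 0 c d x := by
  -- In its own tetrad u has constant components, so only connection coefficients survive in its
  -- gradient.
  have hcov : ∀ a c, S.covVec (fun b _ => uUp b) a c = S.Γ a 0 c := by
    intro a c
    funext y
    simp [covVec, dd_const, uUp]
  rw [← hR a d c]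
  simp only [covVec2, hcov, riemann]
  have hsum : ∑ f, (S.Γ f 0 d x * S.Γ a f c x - S.Γ f 0 c x * S.Γ a f d x
        - S.γ f c d x * S.Γ a 0 f x)
      = ∑ f, (S.Γ a f c x * S.Γ f 0 d x - S.Γ f d c x * S.Γ a 0 f x)
        - ∑ f, (S.Γ a f d x * S.Γ f 0 c x - S.Γ f c d x * S.Γ a 0 f x) := by
    rw [← Finset.sum_sub_distrib]
    refine Finset.sum_congr rfl fun f _ => ?_
    rw [← hS.Γ_sub hx f c d]
    ring
  rw [hsum]
  ring

/-! ### Exterior calculus in the tetrad -/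

variable (S) in
/-- The components `(dw)_cd` of the exterior derivative of a one-form. -/
def extD₁ (w : Fin 4 → Pt → ℝ) (c d : Fin 4) (x : Pt) : ℝ :=
  S.dd c (w d) x - S.dd d (w c) x - ∑ f, S.γ f c d x * w f x

variable (S) in
/-- The components `(dk)_cde` of the exterior derivative of a two-form. -/
def extD₂ (k : Fin 4 → Fin 4 → Pt → ℝ) (c d e : Fin 4) (x : Pt) : ℝ :=
  S.dd e (k c d) x + S.dd c (k d e) x + S.dd d (k e c) x
    + ∑ f, (S.γ f c e x * k f d x + S.γ f d c x * k f e x + S.γ f e d x * k f c x)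

variable (S) in
/-- The component `(dl)_0123` of the exterior derivative of a three-form. -/
def extD₃ (l : Fin 4 → Fin 4 → Fin 4 → Pt → ℝ) (x : Pt) : ℝ :=
  S.dd 0 (l 1 2 3) x - S.dd 1 (l 0 2 3) x + S.dd 2 (l 0 1 3) x - S.dd 3 (l 0 1 2) x
    - ∑ f, (S.γ f 0 1 x * l f 2 3 x - S.γ f 0 2 x * l f 1 3 x + S.γ f 0 3 x * l f 1 2 x
      + S.γ f 1 2 x * l f 0 3 x - S.γ f 1 3 x * l f 0 2 x + S.γ f 2 3 x * l f 0 1 x)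

/-- The components `(w ∧ k)_cde` of the product of a one-form and a two-form. -/
def wedge (w : Fin 4 → Pt → ℝ) (k : Fin 4 → Fin 4 → Pt → ℝ) (c d e : Fin 4) (x : Pt) : ℝ :=
  w c x * k d e x + w d x * k e c x + w e x * k c d x

theorem extD₃_congr {l l' : Fin 4 → Fin 4 → Fin 4 → Pt → ℝ}
    (h : ∀ c d e, l c d e =ᶠ[nhds x] l' c d e) : S.extD₃ l x = S.extD₃ l' x := by
  simp only [extD₃, dd_congr _ (h _ _ _), (h _ _ _).eq_of_nhds]

theorem extD₃_zero : S.extD₃ (fun _ _ _ _ => 0) x = 0 := by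
  simp [extD₃, dd_const]

theorem extD₃_add {l l' : Fin 4 → Fin 4 → Fin 4 → Pt → ℝ}
    (h : ∀ c d e, DifferentiableAt ℝ (l c d e) x) (h' : ∀ c d e, DifferentiableAt ℝ (l' c d e) x) :
    S.extD₃ (fun c d e y => l c d e y + l' c d e y) x = S.extD₃ l x + S.extD₃ l' x := by
  simp only [extD₃, dd_add _ (h _ _ _) (h' _ _ _), Fin.sum_univ_four]
  ring

theorem extD₃_sub {l l' : Fin 4 → Fin 4 → Fin 4 → Pt → ℝ}
    (h : ∀ c d e, DifferentiableAt ℝ (l c d e) x) (h' : ∀ c d e, DifferentiableAt ℝ (l' c d e) x) :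
    S.extD₃ (fun c d e y => l c d e y - l' c d e y) x = S.extD₃ l x - S.extD₃ l' x := by
  simp only [extD₃, dd_sub _ (h _ _ _) (h' _ _ _), Fin.sum_univ_four]
  ring

theorem extD₃_sum {l : Fin 4 → Fin 4 → Fin 4 → Fin 4 → Pt → ℝ}
    (h : ∀ i c d e, DifferentiableAt ℝ (l i c d e) x) :
    S.extD₃ (fun c d e y => ∑ i, l i c d e y) x = ∑ i, S.extD₃ (l i) x := by
  simp only [Fin.sum_univ_four]
  rw [extD₃_add (l' := l 3) (by fun_prop) (by fun_prop),
    extD₃_add (l' := l 2) (by fun_prop) (by fun_prop),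
    extD₃_add (l' := l 1) (by fun_prop) (by fun_prop)]

theorem eq_zero_of_antisymm {k : Fin 4 → Fin 4 → ℝ} (hk : ∀ a b, k a b = -k b a) (a : Fin 4) :
    k a a = 0 := by
  linarith [hk a a]

/-- The graded Leibniz rule d(w ∧ k) = dw ∧ k - w ∧ dk, written out for the single component 0123.
-/
theorem IsRegularOn.extD₃_wedge (hS : S.IsRegularOn U) (hx : x ∈ U)
    {w : Fin 4 → Pt → ℝ} {k : Fin 4 → Fin 4 → Pt → ℝ}
    (hw : ∀ c, DifferentiableAt ℝ (w c) x) (hk : ∀ c d, DifferentiableAt ℝ (k c d) x)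
    (hanti : ∀ c d, k c d =ᶠ[nhds x] fun y => -k d c y) :
    S.extD₃ (wedge w k) x =
      (S.extD₁ w 0 1 x * k 2 3 x - S.extD₁ w 0 2 x * k 1 3 x + S.extD₁ w 0 3 x * k 1 2 x
        + S.extD₁ w 1 2 x * k 0 3 x - S.extD₁ w 1 3 x * k 0 2 x + S.extD₁ w 2 3 x * k 0 1 x)
      - (w 0 x * S.extD₂ k 1 2 3 x - w 1 x * S.extD₂ k 0 2 3 x + w 2 x * S.extD₂ k 0 1 3 x
        - w 3 x * S.extD₂ k 0 1 2 x) := by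
  have hdd : ∀ f c d e, S.dd f (wedge w k c d e) x =
      (S.dd f (w c) x * k d e x + w c x * S.dd f (k d e) x)
      + (S.dd f (w d) x * k e c x + w d x * S.dd f (k e c) x)
      + (S.dd f (w e) x * k c d x + w e x * S.dd f (k c d) x) := by
    intro f c d e
    have h1 := dd_mul (S := S) f (hw c) (hk d e)
    have h2 := dd_mul (S := S) f (hw d) (hk e c)
    have h3 := dd_mul (S := S) f (hw e) (hk c d)
    rw [← h1, ← h2, ← h3, ← dd_add f (by fun_prop) (by fun_prop),
      ← dd_add f (by fun_prop) (by fun_prop)]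
    rfl
  have hγ := fun c a b => hS.γ_antisymm hx c a b
  have hk0 : ∀ c d, k c d x = -k d c x := fun c d => (hanti c d).eq_of_nhds
  have hk1 : ∀ f c d, S.dd f (k c d) x = -S.dd f (k d c) x := fun f c d => by
    rw [← dd_neg]
    exact dd_congr f (hanti c d)
  have hkd := eq_zero_of_antisymm hk0
  simp only [extD₃, hdd, extD₁, extD₂, wedge, Fin.sum_univ_four, hkd,
    hγ _ 1 0, hγ _ 2 0, hγ _ 2 1, hγ _ 3 1, hγ _ 3 2,
    hk0 1 0, hk0 2 0, hk0 3 0, hk0 2 1, hk0 3 1, hk0 3 2,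
    hk1 _ 2 0, hk1 _ 3 0, hk1 _ 3 1]
  ring

theorem IsRegularOn.dd_extD₂ (hS : S.IsRegularOn U) (hU : IsOpen U) (hx : x ∈ U)
    {k : Fin 4 → Fin 4 → Pt → ℝ} (hk : ∀ c d, ContDiffAt ℝ ∞ (k c d) x) (i c d e : Fin 4) :
    S.dd i (S.extD₂ k c d e) x =
      S.dd i (S.dd e (k c d)) x + S.dd i (S.dd c (k d e)) x + S.dd i (S.dd d (k e c)) x
      + ∑ f, ((S.dd i (S.γ f c e) x * k f d x + S.γ f c e x * S.dd i (k f d) x)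
        + (S.dd i (S.γ f d c) x * k f e x + S.γ f d c x * S.dd i (k f e) x)
        + (S.dd i (S.γ f e d) x * k f c x + S.γ f e d x * S.dd i (k f c) x)) := by
  have hk' := fun c d => differentiableAt_of_contDiffAt (hk c d)
  have hγ := fun c a b => differentiableAt_of_contDiffAt (hS.contDiffAt_γ hU hx c a b)
  have hdk := fun a c d =>
    differentiableAt_of_contDiffAt (contDiffAt_dd (hS.contDiffAt_e hU hx a) (hk c d))
  have hsum : S.dd i (fun y => ∑ f, (S.γ f c e y * k f d y + S.γ f d c y * k f e y
        + S.γ f e d y * k f c y)) x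
      = ∑ f, ((S.dd i (S.γ f c e) x * k f d x + S.γ f c e x * S.dd i (k f d) x)
        + (S.dd i (S.γ f d c) x * k f e x + S.γ f d c x * S.dd i (k f e) x)
        + (S.dd i (S.γ f e d) x * k f c x + S.γ f e d x * S.dd i (k f c) x)) := by
    rw [dd_sum _ i fun f _ => by fun_prop]
    refine Finset.sum_congr rfl fun f _ => ?_
    rw [dd_add i (by fun_prop) (by fun_prop), dd_add i (by fun_prop) (by fun_prop),
      dd_mul i (hγ _ _ _) (hk' _ _), dd_mul i (hγ _ _ _) (hk' _ _), dd_mul i (hγ _ _ _) (hk' _ _)]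
  rw [← hsum, ← dd_add i (hdk _ _ _) (hdk _ _ _), ← dd_add i (by fun_prop) (hdk _ _ _),
    ← dd_add i (by fun_prop) (by fun_prop)]
  rfl

/-- d² = 0 on two-forms: second derivatives pair up into commutators, and what multiplies k itself
is a Jacobi expression. -/
theorem IsRegularOn.extD₃_extD₂ (hS : S.IsRegularOn U) (hU : IsOpen U) (hx : x ∈ U)
    (hJ : S.Jacobi x) {k : Fin 4 → Fin 4 → Pt → ℝ} (hk : ∀ c d, ContDiffAt ℝ ∞ (k c d) x)
    (hanti : ∀ c d, k c d =ᶠ[nhds x] fun y => -k d c y) :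
    S.extD₃ (S.extD₂ k) x = 0 := by
  have hγ := fun c a b => hS.γ_antisymm hx c a b
  have hγ1 := fun i c a b => hS.dd_γ_antisymm hU hx i c a b
  have hk0 : ∀ c d, k c d x = -k d c x := fun c d => (hanti c d).eq_of_nhds
  have hk1' : ∀ f c d, S.dd f (k c d) =ᶠ[nhds x] fun y => -S.dd f (k d c) y := fun f c d => by
    filter_upwards [(hanti c d).eventually_nhds] with y hy
    rw [← dd_neg]
    exact dd_congr f hy
  have hk1 : ∀ f c d, S.dd f (k c d) x = -S.dd f (k d c) x := fun f c d => (hk1' f c d).eq_of_nhds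
  have hk2 : ∀ i f c d, S.dd i (S.dd f (k c d)) x = -S.dd i (S.dd f (k d c)) x := fun i f c d => by
    rw [← dd_neg]
    exact dd_congr i (hk1' f c d)
  have hkd := eq_zero_of_antisymm hk0
  have hγd := fun c => eq_zero_of_antisymm (hγ c)
  have hk1d := fun f => eq_zero_of_antisymm (hk1 f)
  have hcomm := fun c d a b => hS.dd_dd_sub hU hx (hk c d) a b
  have hJac := fun a b c d => hJ a b c d
  simp only [Fin.sum_univ_four] at hcomm hJac
  have h012 := hJac 0 1 2
  have h013 := hJac 0 1 3
  have h023 := hJac 0 2 3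
  have h123 := hJac 1 2 3
  simp only [hγd, hγ _ 1 0, hγ _ 2 0, hγ _ 3 0, hγ _ 2 1, hγ _ 3 1, hγ _ 3 2,
    hγ1 _ _ 2 0, hγ1 _ _ 3 0, hγ1 _ _ 3 1] at h012 h013 h023 h123
  simp only [extD₃, hS.dd_extD₂ hU hx hk, extD₂, Fin.sum_univ_four, hkd, hγd, hk1d,
    hγ _ 1 0, hγ _ 2 0, hγ _ 3 0, hγ _ 2 1, hγ _ 3 1, hγ _ 3 2,
    hγ1 _ _ 1 0, hγ1 _ _ 2 0, hγ1 _ _ 2 1, hγ1 _ _ 3 1, hγ1 _ _ 3 2,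
    hk0 1 0, hk0 2 0, hk0 3 0, hk0 2 1, hk0 3 1, hk0 3 2,
    hk1 _ 1 0, hk1 _ 2 0, hk1 _ 3 0, hk1 _ 2 1, hk1 _ 3 1, hk1 _ 3 2,
    hk2 _ _ 2 0, hk2 _ _ 3 0, hk2 _ _ 3 1]
  -- Each commutator [e_a, e_b] acts on the component of k with the two complementary indices; the
  -- remaining terms are Jacobi equations with components of k as coefficients.
  linear_combination hcomm 2 3 0 1 - hcomm 1 3 0 2 + hcomm 1 2 0 3 + hcomm 0 3 1 2
    - hcomm 0 2 1 3 + hcomm 0 1 2 3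
    - (k 0 3 x * h012 0 + k 1 3 x * h012 1 + k 2 3 x * h012 2)
    + (k 0 2 x * h013 0 + k 1 2 x * h013 1 - k 2 3 x * h013 3)
    - (k 0 1 x * h023 0 - k 1 2 x * h023 2 - k 1 3 x * h023 3)
    + (- k 0 1 x * h123 1 - k 0 2 x * h123 2 - k 0 3 x * h123 3)

end Fields

/-! ### Components of the algebraic tensors -/

theorem g_eq (a b : Fin 4) : g a b =
    (!![-1, 0, 0, 0; 0, 1, 0, 0; 0, 0, 1, 0; 0, 0, 0, 1] : Matrix (Fin 4) (Fin 4) ℝ) a b := by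
  fin_cases a <;> fin_cases b <;> simp [g]

theorem uLow_eq (a : Fin 4) : uLow a = (![-1, 0, 0, 0] : Fin 4 → ℝ) a := by
  fin_cases a <;> simp [uLow, uUp, g]

theorem h_eq (a b : Fin 4) : h a b =
    (!![0, 0, 0, 0; 0, 1, 0, 0; 0, 0, 1, 0; 0, 0, 0, 1] : Matrix (Fin 4) (Fin 4) ℝ) a b := by
  fin_cases a <;> fin_cases b <;> simp [h, g, uLow_eq]

theorem h_comm (a b : Fin 4) : h a b = h b a := by
  rw [h, h, g_comm a b, mul_comm]

theorem extVec_eq (v : Fin 3 → ℝ) (a : Fin 4) : extVec v a = ![0, v 0, v 1, v 2] a := by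
  fin_cases a <;> rfl

theorem extMat_eq (M : Matrix (Fin 3) (Fin 3) ℝ) (a b : Fin 4) : extMat M a b =
    !![0, 0, 0, 0; 0, M 0 0, M 0 1, M 0 2; 0, M 1 0, M 1 1, M 1 2; 0, M 2 0, M 2 1, M 2 2] a b := by
  fin_cases a <;> fin_cases b <;> rfl

theorem extMat_symm {M : Matrix (Fin 3) (Fin 3) ℝ} (hM : M.IsSymm) (a b : Fin 4) :
    extMat M a b = extMat M b a := by
  induction a using Fin.cases <;> induction b using Fin.cases
  · rfl
  · rfl
  · rfl
  · exact hM.apply _ _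

/-- On the indices `0, …, 3` the tensor `η_abc0` is an alternating product of differences. -/
theorem eta_zero_right (a b c : Fin 4) : eta a b c 0 =
    (a : ℕ) * (b : ℕ) * (c : ℕ) * ((b : ℕ) - (a : ℕ)) * ((c : ℕ) - (a : ℕ))
      * ((c : ℕ) - (b : ℕ)) / 12 := by
  -- The factors a, b, c exclude a second index 0, the differences exclude repetitions, and 12 is
  -- the value of the product at (1, 2, 3). Over ℤ the identity is a finite check.
  have key : ∀ a b c : Fin 4,
      -(Matrix.of fun i j : Fin 4 => if ![a, b, c, 0] i = j then (1 : ℤ) else 0).det * 12 =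
        (a : ℕ) * (b : ℕ) * (c : ℕ) * ((b : ℕ) - (a : ℕ)) * ((c : ℕ) - (a : ℕ))
          * ((c : ℕ) - (b : ℕ)) := by
    intro a b c
    rw [Matrix.det_succ_row _ 3, Fin.sum_univ_four]
    simp only [Matrix.det_fin_three, Matrix.submatrix_apply, Matrix.of_apply]
    revert a b c
    set_option maxRecDepth 100000 in
    decide
  have := congrArg (Int.cast : ℤ → ℝ) (key a b c)
  push_cast at this
  rw [eta, ← this]
  push_cast
  ring

theorem eps_eq (a b c : Fin 4) : eps a b c =
    (a : ℕ) * (b : ℕ) * (c : ℕ) * ((b : ℕ) - (a : ℕ)) * ((c : ℕ) - (a : ℕ))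
      * ((c : ℕ) - (b : ℕ)) / 12 := by
  rw [← eta_zero_right]
  simp [eps, uUp]

theorem eps_antisymm (a b c : Fin 4) : eps a b c = -eps b a c := by
  rw [eps_eq, eps_eq]
  ring

/-! ### Symmetries, trace and time components of the curvature variable K. -/

namespace Fields

variable {S : Fields} {U : Set Pt} {x : Pt}

theorem KUp_eq (a b c d : Fin 4) (x : Pt) : S.KUp a b c d x = g a a * S.K a b c d x :=
  sum_g_mul a fun f => S.K f b c d x

theorem IsRegularOn.T_symm (hS : S.IsRegularOn U) (hx : x ∈ U) (a b : Fin 4) :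
    S.T a b x = S.T b a x := by
  simp only [T]
  rw [extMat_symm (hS.symm_aniso x hx) a b, h_comm a b]
  ring

theorem IsRegularOn.ric_symm (hS : S.IsRegularOn U) (hx : x ∈ U) (a b : Fin 4) :
    S.ric a b x = S.ric b a x := by
  rw [ric, ric, hS.T_symm hx a b, g_comm a b]

theorem K_antisymm (a b c d : Fin 4) (x : Pt) : S.K a b c d x = -S.K a b d c x := by
  simp only [K, weyl]
  simp only [eps_antisymm d c, mul_sub, neg_mul, Finset.sum_sub_distrib, Finset.sum_neg_distrib]
  ring

theorem K_antisymm_left (a b c d : Fin 4) (x : Pt) : S.K a b c d x = -S.K b a c d x := by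
  simp only [K, weyl]
  simp only [eps_antisymm b a, mul_sub, neg_mul, Finset.sum_sub_distrib, Finset.sum_neg_distrib]
  rw [g_comm c a, g_comm c b, g_comm d a, g_comm d b]
  ring

theorem IsRegularOn.K_pair_symm (hS : S.IsRegularOn U) (hx : x ∈ U) (a b c d : Fin 4) :
    S.K a b c d x = S.K c d a b x := by
  simp only [K, weyl]
  rw [extMat_symm (hS.symm_E x hx) d b, extMat_symm (hS.symm_E x hx) c b,
    extMat_symm (hS.symm_E x hx) d a, extMat_symm (hS.symm_E x hx) c a, h_comm c a, h_comm d a,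
    h_comm c b, h_comm d b, g_comm c a, g_comm c b, g_comm d a, g_comm d b, hS.ric_symm hx d b,
    hS.ric_symm hx c b, hS.ric_symm hx c a, hS.ric_symm hx d a]
  ring

/-- The Weyl part is trace-free and the remaining terms are the standard decomposition. This ties
the field equations to the contraction of K - R. -/
theorem IsRegularOn.K_trace (hS : S.IsRegularOn U) (hx : x ∈ U) (b d : Fin 4) :
    ∑ a, g a a * S.K a b a d x = S.ric b d x := by
  have hE := hS.trace_E x hx
  rw [Matrix.trace_fin_three] at hE
  have hEs := fun i j => (hS.symm_E x hx).apply i j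
  have hHs := fun i j => (hS.symm_H x hx).apply i j
  have hRs := hS.ric_symm hx
  have htr : -S.ric 0 0 x + S.ric 1 1 x + S.ric 2 2 x + S.ric 3 3 x = -S.trT x := by
    simp [trT, ric, Fin.sum_univ_four, g_eq]
    ring
  have hweyl : ∑ a, g a a * S.weyl a b a d x = 0 := by
    simp only [weyl, eps_eq, h_eq, g_eq, uLow_eq, extMat_eq, Fin.sum_univ_four]
    fin_cases b <;> fin_cases d <;> simp <;>
      linarith [hEs 0 1, hEs 0 2, hEs 1 2, hHs 0 1, hHs 0 2, hHs 1 2]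
  have hric : ∑ a, g a a * (S.K a b a d x - S.weyl a b a d x) = S.ric b d x := by
    simp only [K, g_eq, Fin.sum_univ_four]
    fin_cases b <;> fin_cases d <;> simp <;>
      linarith [hRs 0 1, hRs 0 2, hRs 0 3, hRs 1 2, hRs 1 3, hRs 2 3]
  rw [← hric, ← sub_eq_zero, ← Finset.sum_sub_distrib, ← hweyl]
  exact Finset.sum_congr rfl fun a _ => by ring

/-- Only the multiple of the identity involves ρ and p. It cancels in the commutator later, so its
coefficient is merely read off from one diagonal component. -/
theorem IsRegularOn.K_electric (hS : S.IsRegularOn U) (hx : x ∈ U) (α β : Fin 3) :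
    S.K 0 α.succ 0 β.succ x = S.I x α β + (S.K 0 3 0 3 x - S.I x 2 2) * g α.succ β.succ := by
  have hEs := fun i j => (hS.symm_E x hx).apply i j
  have hPs := fun i j => (hS.symm_aniso x hx).apply i j
  simp only [K, weyl, ric, T, I, eps_eq, h_eq, g_eq, uLow_eq, extMat_eq, extVec_eq,
    Fin.sum_univ_four]
  fin_cases α <;> fin_cases β <;> simp <;>
    linarith [hEs 0 1, hEs 0 2, hEs 1 2, hPs 0 1, hPs 0 2, hPs 1 2]

/-- The first index pair is dualised to one spatial index. The mixed components of the Ricci-type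
tensor contribute q, which is the antisymmetric part of J. -/
theorem IsRegularOn.K_magnetic (hS : S.IsRegularOn U) (hx : x ∈ U) (γ : Fin 3) :
    S.K 2 3 0 γ.succ x = -S.J x 0 γ ∧ S.K 3 1 0 γ.succ x = -S.J x 1 γ ∧
      S.K 1 2 0 γ.succ x = -S.J x 2 γ := by
  have hHs := fun i j => (hS.symm_H x hx).apply i j
  simp only [K, weyl, ric, T, J, eps_eq, h_eq, g_eq, uLow_eq, extMat_eq, extVec_eq,
    Fin.sum_univ_four, uUp]
  refine ⟨?_, ?_, ?_⟩ <;> fin_cases γ <;> simp [eta_zero_right] <;>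
    linarith [hHs 0 1, hHs 0 2, hHs 1 2]

theorem IsRegularOn.contDiffAt_KUp (hS : S.IsRegularOn U) (hU : IsOpen U) (hx : x ∈ U)
    (a b c d : Fin 4) : ContDiffAt ℝ ∞ (S.KUp a b c d) x := by
  have hxU := hU.mem_nhds hx
  have hmat : ∀ (M : Pt → Matrix (Fin 3) (Fin 3) ℝ),
      (∀ α β, ContDiffOn ℝ ∞ (fun x => M x α β) U) →
      ∀ a b, ContDiffAt ℝ ∞ (fun x => extMat (M x) a b) x := by
    intro M hM a b
    induction a using Fin.cases with
    | zero => exact contDiffAt_const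
    | succ α =>
      induction b using Fin.cases with
      | zero => exact contDiffAt_const
      | succ β => exact (hM α β).contDiffAt hxU
  have hE := hmat S.E hS.smooth_E
  have hH := hmat S.H hS.smooth_H
  have hP := hmat S.aniso hS.smooth_aniso
  have hq : ∀ a, ContDiffAt ℝ ∞ (fun x => extVec (S.q x) a) x := by
    intro a
    induction a using Fin.cases with
    | zero => exact contDiffAt_const
    | succ α => exact (hS.smooth_q α).contDiffAt hxU
  have hρ := hS.smooth_ρ.contDiffAt hxU
  have hp := hS.smooth_p.contDiffAt hxU
  have hT : ∀ a b, ContDiffAt ℝ ∞ (S.T a b) x := by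
    intro a b
    unfold T
    fun_prop
  have htr : ContDiffAt ℝ ∞ S.trT x := by
    unfold trT
    fun_prop
  have hric : ∀ a b, ContDiffAt ℝ ∞ (S.ric a b) x := by
    intro a b
    unfold ric
    fun_prop
  have hweyl : ∀ a b c d, ContDiffAt ℝ ∞ (S.weyl a b c d) x := by
    intro a b c d
    unfold weyl
    fun_prop
  unfold KUp K
  fun_prop

end Fields

/-- The commutator form of the twice differentiated second Bianchi equations: if
`dK = -(G ∧ K - K ∧ G)` and `R = dG + G ∧ G`, then `d(G ∧ K - K ∧ G) = 0` means
`R ∧ K - K ∧ R = 0`. -/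
theorem commutator_eq_zero_of_integrability {A : Type*} [Ring A] (G : Fin 4 → A)
    (K dG : Fin 4 → Fin 4 → A) (dK : Fin 4 → Fin 4 → Fin 4 → A)
    (hdK : ∀ c d e, dK c d e + ((G c * K d e + G d * K e c + G e * K c d)
      - (K d e * G c + K e c * G d + K c d * G e)) = 0)
    (hK : ∀ c d, K c d = -K d c)
    (h : (dG 0 1 * K 2 3 - dG 0 2 * K 1 3 + dG 0 3 * K 1 2 + dG 1 2 * K 0 3 - dG 1 3 * K 0 2
          + dG 2 3 * K 0 1)
        - (G 0 * dK 1 2 3 - G 1 * dK 0 2 3 + G 2 * dK 0 1 3 - G 3 * dK 0 1 2)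
        - (K 2 3 * dG 0 1 - K 1 3 * dG 0 2 + K 1 2 * dG 0 3 + K 0 3 * dG 1 2 - K 0 2 * dG 1 3
          + K 0 1 * dG 2 3)
        + (dK 1 2 3 * G 0 - dK 0 2 3 * G 1 + dK 0 1 3 * G 2 - dK 0 1 2 * G 3) = 0)
    {R : Fin 4 → Fin 4 → A} (hR : ∀ c d, R c d = dG c d + G c * G d - G d * G c) :
    (R 0 1 * K 2 3 - R 0 2 * K 1 3 + R 0 3 * K 1 2 + R 1 2 * K 0 3 - R 1 3 * K 0 2 + R 2 3 * K 0 1)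
      - (K 2 3 * R 0 1 - K 1 3 * R 0 2 + K 1 2 * R 0 3 + K 0 3 * R 1 2 - K 0 2 * R 1 3
        + K 0 1 * R 2 3) = 0 := by
  have hdK' := fun c d e => eq_neg_of_add_eq_zero_left (hdK c d e)
  rw [← h]
  simp only [hR, hdK', hK 2 0, hK 3 0, hK 3 1]
  noncomm_ring

/-! ### The second Bianchi equations as a matrix-valued exterior equation, and its differential. -/

namespace Fields

variable {S : Fields} {U : Set Pt} {x : Pt}

/-- Under the cyclic sum the connection terms on the form indices combine, by vanishing torsion,
into the γ terms of dK. Those on a and b form Γ∧K - K∧Γ. -/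
theorem IsRegularOn.covK_cyclic (hS : S.IsRegularOn U) (hx : x ∈ U) (a b c d e : Fin 4) :
    S.covK a b c d e x + S.covK a b d e c x + S.covK a b e c d x =
      S.extD₂ (S.KUp a b) c d e x + ∑ i, (wedge (S.Γ a i) (S.KUp i b) c d e x
        - wedge (S.Γ i b) (S.KUp a i) c d e x) := by
  have hK : ∀ c d, S.KUp a b c d x = -S.KUp a b d c x := fun c d => by
    rw [KUp_eq, KUp_eq, K_antisymm]
    ring
  have hsum : ∑ f, (S.Γ a f e x * S.KUp f b c d x - S.Γ f b e x * S.KUp a f c d x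
        - S.Γ f c e x * S.KUp a b f d x - S.Γ f d e x * S.KUp a b c f x)
      + ∑ f, (S.Γ a f c x * S.KUp f b d e x - S.Γ f b c x * S.KUp a f d e x
        - S.Γ f d c x * S.KUp a b f e x - S.Γ f e c x * S.KUp a b d f x)
      + ∑ f, (S.Γ a f d x * S.KUp f b e c x - S.Γ f b d x * S.KUp a f e c x
        - S.Γ f e d x * S.KUp a b f c x - S.Γ f c d x * S.KUp a b e f x)
      = ∑ f, (S.γ f c e x * S.KUp a b f d x + S.γ f d c x * S.KUp a b f e x
          + S.γ f e d x * S.KUp a b f c x)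
        + ∑ i, (wedge (S.Γ a i) (S.KUp i b) c d e x - wedge (S.Γ i b) (S.KUp a i) c d e x) := by
    simp only [← Finset.sum_add_distrib]
    refine Finset.sum_congr rfl fun f _ => ?_
    rw [← hS.Γ_sub hx f c e, ← hS.Γ_sub hx f d c, ← hS.Γ_sub hx f e d, hK c f, hK d f, hK e f]
    simp only [wedge]
    ring
  simp only [covK, extD₂]
  linear_combination hsum

variable (S) in
/-- The matrix `K^a_bcd`, with `c` and `d` fixed. -/
def KMat (x : Pt) (c d : Fin 4) : Matrix (Fin 4) (Fin 4) ℝ := Matrix.of fun a b => S.KUp a b c d x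

variable (S) in
/-- The curvature matrix `R^a_bcd`, with `c` and `d` fixed. -/
def riemannMat (x : Pt) (c d : Fin 4) : Matrix (Fin 4) (Fin 4) ℝ :=
  Matrix.of fun a b => S.riemann a b c d x

theorem KMat_antisymm (x : Pt) (c d : Fin 4) : S.KMat x c d = -S.KMat x d c := by
  ext a b
  simp only [KMat, Matrix.of_apply, Matrix.neg_apply, KUp_eq]
  rw [K_antisymm]
  ring

/-- The integrability conditions of the second Bianchi equations. -/
theorem IsRegularOn.commutator_riemannMat_KMat (hS : S.IsRegularOn U) (hU : IsOpen U) (hx : x ∈ U)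
    (hJ : S.Jacobi x) (hB : ∀ y ∈ U, S.Bianchi y) :
    (S.riemannMat x 0 1 * S.KMat x 2 3 - S.riemannMat x 0 2 * S.KMat x 1 3
        + S.riemannMat x 0 3 * S.KMat x 1 2 + S.riemannMat x 1 2 * S.KMat x 0 3
        - S.riemannMat x 1 3 * S.KMat x 0 2 + S.riemannMat x 2 3 * S.KMat x 0 1)
      - (S.KMat x 2 3 * S.riemannMat x 0 1 - S.KMat x 1 3 * S.riemannMat x 0 2
        + S.KMat x 1 2 * S.riemannMat x 0 3 + S.KMat x 0 3 * S.riemannMat x 1 2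
        - S.KMat x 0 2 * S.riemannMat x 1 3 + S.KMat x 0 1 * S.riemannMat x 2 3) = 0 := by
  have hΓ := fun a b c => differentiableAt_of_contDiffAt (hS.contDiffAt_Γ hU hx a b c)
  have hγ := fun a b c => differentiableAt_of_contDiffAt (hS.contDiffAt_γ hU hx a b c)
  have hK := fun a b c d => differentiableAt_of_contDiffAt (hS.contDiffAt_KUp hU hx a b c d)
  have hdK := fun i a b c d => differentiableAt_of_contDiffAt
    (contDiffAt_dd (hS.contDiffAt_e hU hx i) (hS.contDiffAt_KUp hU hx a b c d))
  have hanti : ∀ a b c d, S.KUp a b c d =ᶠ[nhds x] fun y => -S.KUp a b d c y := by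
    intro a b c d
    refine Filter.Eventually.of_forall fun y => ?_
    simp only [KUp_eq]
    rw [K_antisymm]
    ring
  have hwedge : ∀ a b i j c d e, DifferentiableAt ℝ (wedge (S.Γ a b) (S.KUp i j) c d e) x := by
    intro a b i j c d e
    unfold wedge
    fun_prop
  have hext : ∀ a b c d e, DifferentiableAt ℝ (S.extD₂ (S.KUp a b) c d e) x := by
    intro a b c d e
    unfold extD₂
    fun_prop
  refine commutator_eq_zero_of_integrability (fun c => Matrix.of fun a b => S.Γ a b c x) (S.KMat x)
    (fun c d => Matrix.of fun a b => S.extD₁ (S.Γ a b) c d x)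
    (fun c d e => Matrix.of fun a b => S.extD₂ (S.KUp a b) c d e x) ?_ (KMat_antisymm x) ?_ ?_
  · intro c d e
    ext a b
    have h := hB x hx a b c d e
    rw [hS.covK_cyclic hx] at h
    simp only [KMat, Matrix.add_apply, Matrix.sub_apply, Matrix.mul_apply, Matrix.of_apply,
      Matrix.zero_apply, wedge] at h ⊢
    rw [← h]
    simp only [Fin.sum_univ_four]
    ring
  · ext a b
    -- The Bianchi equations hold on a whole neighbourhood, so d may be applied to them.
    have h : S.extD₃ (fun c d e y => S.extD₂ (S.KUp a b) c d e y
        + ∑ i, (wedge (S.Γ a i) (S.KUp i b) c d e y - wedge (S.Γ i b) (S.KUp a i) c d e y)) x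
        = 0 := by
      rw [← extD₃_zero (S := S) (x := x)]
      refine extD₃_congr fun c d e => Filter.eventually_of_mem (hU.mem_nhds hx) fun y hy => ?_
      exact (hS.covK_cyclic hy a b c d e).symm.trans (hB y hy a b c d e)
    rw [extD₃_add (hext a b) (by fun_prop),
      hS.extD₃_extD₂ hU hx hJ (hS.contDiffAt_KUp hU hx a b) (hanti a b),
      extD₃_sum (by fun_prop)] at h
    simp only [extD₃_sub (hwedge _ _ _ _) (hwedge _ _ _ _),
      hS.extD₃_wedge hx (hΓ _ _) (hK _ _) (hanti _ _)] at h
    simp only [KMat, Matrix.add_apply, Matrix.sub_apply, Matrix.mul_apply, Matrix.of_apply,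
      Matrix.zero_apply]
    rw [← h]
    simp only [Fin.sum_univ_four]
    ring
  · intro c d
    ext a b
    simp only [riemannMat, riemann, extD₁, Matrix.add_apply, Matrix.sub_apply, Matrix.mul_apply,
      Matrix.of_apply, Fin.sum_univ_four]
    ring

end Fields

/-! ### Linear algebra of the generic case -/

section LinearAlgebra

variable {A B C H Y : Matrix (Fin 3) (Fin 3) ℝ}

theorem mulVec_mem_eigenspace (hAB : Commute A B) {μ : ℝ} {v : Fin 3 → ℝ}
    (hv : v ∈ Module.End.eigenspace (Matrix.toLin' A) μ) :
    B *ᵥ v ∈ Module.End.eigenspace (Matrix.toLin' A) μ := by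
  rw [Module.End.mem_eigenspace_iff, Matrix.toLin'_apply] at hv ⊢
  rw [Matrix.mulVec_mulVec, hAB.eq, ← Matrix.mulVec_mulVec, hv, Matrix.mulVec_smul]

/-- `B` preserves the eigenspaces of `A`, and these are at most lines. -/
theorem NonDegenerate.exists_mulVec_eq_smul (hA : NonDegenerate A) (hAB : Commute A B) {μ : ℝ}
    {v : Fin 3 → ℝ} (hv0 : v ≠ 0) (hv : v ∈ Module.End.eigenspace (Matrix.toLin' A) μ) :
    ∃ c : ℝ, B *ᵥ v = c • v := by
  obtain ⟨w, hw⟩ := finrank_le_one_iff.mp (hA μ)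
  obtain ⟨c, hc⟩ := hw ⟨v, hv⟩
  obtain ⟨d, hd⟩ := hw ⟨B *ᵥ v, mulVec_mem_eigenspace hAB hv⟩
  have hc' : c • (w : Fin 3 → ℝ) = v := congrArg Subtype.val hc
  have hd' : d • (w : Fin 3 → ℝ) = B *ᵥ v := congrArg Subtype.val hd
  have hc0 : c ≠ 0 := by
    rintro rfl
    exact hv0 (by rw [← hc', zero_smul])
  exact ⟨d / c, by rw [← hd', ← hc', smul_smul, div_mul_cancel₀ d hc0]⟩

theorem isHermitian_of_isSymm (hA : A.IsSymm) : A.IsHermitian := by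
  rw [Matrix.IsHermitian, Matrix.conjTranspose_eq_transpose_of_trivial]
  exact hA

theorem eigenvectorBasis_ne_zero (hA : A.IsHermitian) (j : Fin 3) :
    (hA.eigenvectorBasis j).ofLp ≠ 0 := by
  intro h
  exact hA.eigenvectorBasis.orthonormal.ne_zero j (by ext i; exact congrFun h i)

theorem eigenvectorBasis_mem_eigenspace (hA : A.IsHermitian) (j : Fin 3) :
    (hA.eigenvectorBasis j).ofLp ∈
      Module.End.eigenspace (Matrix.toLin' A) (hA.eigenvalues j) := by
  rw [Module.End.mem_eigenspace_iff, Matrix.toLin'_apply]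
  exact hA.mulVec_eigenvectorBasis j

/-- An orthonormal eigenbasis of `A` diagonalises both `B` and `C`, so the commutator kills every
basis vector. -/
theorem NonDegenerate.commute (hA : NonDegenerate A) (hAs : A.IsSymm) (hAB : Commute A B)
    (hAC : Commute A C) : Commute B C := by
  have hH := isHermitian_of_isSymm hAs
  have hzero : (B * C - C * B) * (hH.eigenvectorUnitary : Matrix (Fin 3) (Fin 3) ℝ) = 0 := by
    refine Matrix.ext_of_mulVec_single fun j => ?_
    rw [← Matrix.mulVec_mulVec, hH.eigenvectorUnitary_mulVec j, Matrix.zero_mulVec]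
    have hne := eigenvectorBasis_ne_zero hH j
    have hmem := eigenvectorBasis_mem_eigenspace hH j
    obtain ⟨b, hb⟩ := hA.exists_mulVec_eq_smul hAB hne hmem
    obtain ⟨c, hc⟩ := hA.exists_mulVec_eq_smul hAC hne hmem
    rw [Matrix.sub_mulVec, ← Matrix.mulVec_mulVec, ← Matrix.mulVec_mulVec, hb, hc,
      Matrix.mulVec_smul, Matrix.mulVec_smul, hb, hc, smul_smul, smul_smul, mul_comm, sub_self]
  have hunit := Matrix.mem_unitaryGroup_iff.mp hH.eigenvectorUnitary.2
  have h0 := congrArg (· * star (hH.eigenvectorUnitary : Matrix (Fin 3) (Fin 3) ℝ)) hzero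
  simp only [Matrix.mul_assoc, hunit, Matrix.mul_one, Matrix.zero_mul] at h0
  exact sub_eq_zero.mp h0

/-- Supplies one common eigenblade, so that avoiding all of them excludes the zero vector; the
choice of eigenvalue is arbitrary. -/
theorem NonDegenerate.isEigenblade_eigenspace (hA : NonDegenerate A) (hAs : A.IsSymm)
    (hAB : Commute A B) :
    IsEigenblade B (Module.End.eigenspace (Matrix.toLin' A)
      ((isHermitian_of_isSymm hAs).eigenvalues 0)) := by
  have hH := isHermitian_of_isSymm hAs
  refine ⟨fun h => ?_, fun h => ?_, fun v hv => mulVec_mem_eigenspace hAB hv⟩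
  · have hmem := eigenvectorBasis_mem_eigenspace hH 0
    rw [h, Submodule.mem_bot] at hmem
    exact eigenvectorBasis_ne_zero hH 0 hmem
  · have hrank := hA (hH.eigenvalues 0)
    rw [h, finrank_top, Module.finrank_fin_fun] at hrank
    omega

/-- A matrix which commutes with a non-degenerate symmetric `A`, and for which `tr Y - Y`
annihilates a vector outside all common eigenblades of `A` and `H`, vanishes. -/
theorem NonDegenerate.eq_zero_of_trace_sub_mulVec (hA : NonDegenerate A) (hAs : A.IsSymm)
    (hAH : Commute A H) (hAY : Commute A Y) {q : Fin 3 → ℝ}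
    (hq : ∀ P, IsEigenblade H P → IsEigenblade A P → q ∉ P)
    (hYq : (Y.trace • (1 : Matrix (Fin 3) (Fin 3) ℝ) - Y) *ᵥ q = 0) : Y = 0 := by
  have hHY : Commute H Y := hA.commute hAs hAH hAY
  set P : Submodule ℝ (Fin 3 → ℝ) :=
    LinearMap.ker (Matrix.toLin' (Y.trace • (1 : Matrix (Fin 3) (Fin 3) ℝ) - Y)) with hP
  have hmemP : ∀ v, v ∈ P ↔ (Y.trace • (1 : Matrix (Fin 3) (Fin 3) ℝ) - Y) *ᵥ v = 0 := fun v => by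
    rw [hP, LinearMap.mem_ker, Matrix.toLin'_apply]
  have hinv : ∀ M : Matrix (Fin 3) (Fin 3) ℝ, Commute M Y → ∀ v ∈ P, M *ᵥ v ∈ P := by
    intro M hM v hv
    rw [hmemP] at hv ⊢
    have hcomm : Commute (Y.trace • (1 : Matrix (Fin 3) (Fin 3) ℝ) - Y) M :=
      ((Commute.one_left M).smul_left _).sub_left hM.symm
    rw [Matrix.mulVec_mulVec, hcomm.eq, ← Matrix.mulVec_mulVec, hv, Matrix.mulVec_zero]
  -- A trivial kernel would force `q = 0`, which lies in every common eigenblade.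
  have hbot : P ≠ ⊥ := by
    intro h
    have hq0 : q = 0 := by
      have := (hmemP q).mpr hYq
      rwa [h, Submodule.mem_bot] at this
    exact hq _ (hA.isEigenblade_eigenspace hAs hAH)
      (hA.isEigenblade_eigenspace hAs (Commute.refl A)) (hq0 ▸ Submodule.zero_mem _)
  have htop : P = ⊤ := by
    by_contra h
    exact hq P ⟨hbot, h, hinv H hHY⟩ ⟨hbot, h, hinv A hAY⟩ ((hmemP q).mpr hYq)
  have hzero : Y.trace • (1 : Matrix (Fin 3) (Fin 3) ℝ) - Y = 0 := by
    rw [hP, LinearMap.ker_eq_top] at htop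
    exact (Matrix.toLin').map_eq_zero_iff.mp htop
  have hY := sub_eq_zero.mp hzero
  -- Taking traces of Y = (tr Y)·1 in dimension three gives 3 tr Y = tr Y.
  have htr := congrArg Matrix.trace hY
  simp only [Matrix.trace_smul, Matrix.trace_one, Fintype.card_fin, smul_eq_mul] at htr
  have htr0 : Y.trace = 0 := by
    push_cast at htr
    linarith
  rw [← hY, htr0, zero_smul]

end LinearAlgebra

namespace Fields

variable {S : Fields} {U : Set Pt} {x : Pt}

/-! ### The deviation of the curvature variable from the curvature -/

variable (S) in
/-- The deviation `K_abcd - R_abcd` of the curvature variable from the curvature. -/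
def dev (a b c d : Fin 4) (x : Pt) : ℝ := S.K a b c d x - g a a * S.riemann a b c d x

theorem IsRegularOn.dev_antisymm (hS : S.IsRegularOn U) (hx : x ∈ U) (a b c d : Fin 4) :
    S.dev a b c d x = -S.dev a b d c x := by
  rw [dev, dev, K_antisymm, hS.riemann_antisymm hx]
  ring

theorem IsRegularOn.dev_antisymm_left (hS : S.IsRegularOn U) (hU : IsOpen U) (hx : x ∈ U)
    (a b c d : Fin 4) : S.dev a b c d x = -S.dev b a c d x := by
  rw [dev, dev, K_antisymm_left, hS.g_mul_riemann hU hx]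
  ring

theorem IsRegularOn.dev_pair_symm (hS : S.IsRegularOn U) (hU : IsOpen U) (hx : x ∈ U)
    (hJ : S.Jacobi x) (a b c d : Fin 4) : S.dev a b c d x = S.dev c d a b x := by
  rw [dev, dev, hS.K_pair_symm hx, hS.riemann_pair_symm hU hx hJ]

theorem IsRegularOn.dev_zero₂ (hS : S.IsRegularOn U) (hx : x ∈ U) (hR : S.RicciU x)
    (a c d : Fin 4) : S.dev a 0 c d x = 0 := by
  rw [dev, hS.riemann_zero hx hR, KUp_eq, ← mul_assoc, g_mul_self]
  ring

theorem IsRegularOn.dev_zero₁ (hS : S.IsRegularOn U) (hU : IsOpen U) (hx : x ∈ U)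
    (hR : S.RicciU x) (b c d : Fin 4) : S.dev 0 b c d x = 0 := by
  rw [hS.dev_antisymm_left hU hx, hS.dev_zero₂ hx hR, neg_zero]

theorem IsRegularOn.dev_zero₃ (hS : S.IsRegularOn U) (hU : IsOpen U) (hx : x ∈ U)
    (hJ : S.Jacobi x) (hR : S.RicciU x) (a b d : Fin 4) : S.dev a b 0 d x = 0 := by
  rw [hS.dev_pair_symm hU hx hJ, hS.dev_zero₁ hU hx hR]

/-- The deviation from the field equations is the Einstein tensor of `dev`. -/
theorem IsRegularOn.T_sub_einstein (hS : S.IsRegularOn U) (hx : x ∈ U) (a b : Fin 4) :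
    S.T a b x - S.einstein a b x = ∑ c, g c c * S.dev c a c b x
      - (1 / 2) * (∑ d, g d d * ∑ c, g c c * S.dev c d c d x) * g a b := by
  have hricci : ∀ b d, S.ricci b d x = S.ric b d x - ∑ c, g c c * S.dev c b c d x := by
    intro b d
    rw [← hS.K_trace hx, ← Finset.sum_sub_distrib, ricci]
    refine Finset.sum_congr rfl fun c _ => ?_
    rw [dev]
    linear_combination -S.riemann c b c d x * g_mul_self c
  have htr : ∑ d, g d d * S.ric d d x = -S.trT x := by
    simp [trT, ric, Fin.sum_univ_four, g_eq]
    ring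
  have hscalar : S.scalar x = -S.trT x - ∑ d, g d d * ∑ c, g c c * S.dev c d c d x := by
    rw [scalar, sum_sum_g_mul, ← htr, ← Finset.sum_sub_distrib]
    refine Finset.sum_congr rfl fun d _ => ?_
    rw [hricci]
    ring
  rw [einstein, hscalar, hricci, ric]
  ring

/-- The components of `dev` in terms of the deviation from the spatial field equations. -/
theorem IsRegularOn.Y_eq (hS : S.IsRegularOn U) (hU : IsOpen U) (hx : x ∈ U)
    (hJ : S.Jacobi x) (hR : S.RicciU x) :
    S.Y x = -!![S.dev 2 3 2 3 x, -S.dev 1 3 2 3 x, S.dev 1 2 2 3 x;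
      -S.dev 1 3 2 3 x, S.dev 1 3 1 3 x, -S.dev 1 2 1 3 x;
      S.dev 1 2 2 3 x, -S.dev 1 2 1 3 x, S.dev 1 2 1 2 x] := by
  have hl := hS.dev_antisymm_left hU hx
  have hr := hS.dev_antisymm hx
  have hp := hS.dev_pair_symm hU hx hJ
  have h1 := hS.dev_zero₁ hU hx hR
  have hld := fun a c d => eq_zero_of_antisymm (fun a b => hl a b c d) a
  have hrd := fun a b => eq_zero_of_antisymm (hr a b)
  ext α β
  simp only [Y, Matrix.of_apply]
  -- With the 0-components gone this is a three-dimensional Einstein tensor, minus the double dual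
  -- of the curvature: all but one component cancel in each entry.
  rw [hS.T_sub_einstein hx]
  simp only [Fin.sum_univ_four, h1, hS.dev_zero₂ hx hR]
  fin_cases α <;> fin_cases β <;>
    simp [g_eq, hld, hrd, hl 2 1, hl 3 1, hl 3 2, hr _ _ 2 1, hr _ _ 3 1, hr _ _ 3 2,
      hp 2 3 1 2, hp 2 3 1 3, hp 1 3 1 2] <;> ring

/-! ### The linear system for Y and its solution at generic points. -/

/-- Splits an element of the Lorentz algebra into a boost given by I, up to the multiple `c` of the
identity, and a rotation given by J. -/
theorem IsRegularOn.KMat_zero_succ (hS : S.IsRegularOn U) (hx : x ∈ U) :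
    ∃ c : ℝ, ∀ γ : Fin 3, S.KMat x 0 γ.succ =
      -!![0, S.I x 0 γ + c * g 1 γ.succ, S.I x 1 γ + c * g 2 γ.succ, S.I x 2 γ + c * g 3 γ.succ;
        S.I x 0 γ + c * g 1 γ.succ, 0, S.J x 2 γ, -S.J x 1 γ;
        S.I x 1 γ + c * g 2 γ.succ, -S.J x 2 γ, 0, S.J x 0 γ;
        S.I x 2 γ + c * g 3 γ.succ, S.J x 1 γ, -S.J x 0 γ, 0] := by
  refine ⟨S.K 0 3 0 3 x - S.I x 2 2, fun γ => ?_⟩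
  obtain ⟨h23, h31, h12⟩ := hS.K_magnetic hx γ
  have h01 := hS.K_electric hx 0 γ
  have h02 := hS.K_electric hx 1 γ
  have h03 := hS.K_electric hx 2 γ
  simp only [Fin.succ_zero_eq_one, Fin.succ_one_eq_two, show (2 : Fin 3).succ = 3 from rfl]
    at h01 h02 h03
  have hl := fun a b => K_antisymm_left (S := S) a b 0 γ.succ x
  have hd := eq_zero_of_antisymm hl
  ext a b
  simp only [KMat, Matrix.of_apply, KUp_eq]
  fin_cases a <;> fin_cases b <;>
    simp [g_eq, hd, h01, h02, h03, h12, h23, h31, hl 1 0, hl 2 0, hl 3 0, hl 2 1, hl 3 2, hl 1 3]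

variable (S) in
/-- The matrix of the components `K^a_bcd - R^a_bcd`, with `c` and `d` fixed. -/
def devMat (x : Pt) (c d : Fin 4) : Matrix (Fin 4) (Fin 4) ℝ :=
  Matrix.of fun a b => g a a * S.dev a b c d x

theorem riemannMat_eq (x : Pt) (c d : Fin 4) :
    S.riemannMat x c d = S.KMat x c d - S.devMat x c d := by
  ext a b
  simp only [riemannMat, KMat, devMat, dev, Matrix.of_apply, Matrix.sub_apply, KUp_eq]
  linear_combination -S.riemann a b c d x * g_mul_self a

/-- Substituting R = K - `dev` in the integrability conditions, the K∧K terms cancel, and `dev` has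
no form component along 0. -/
theorem IsRegularOn.commutator_devMat_KMat (hS : S.IsRegularOn U) (hU : IsOpen U) (hx : x ∈ U)
    (hJ : S.Jacobi x) (hR : S.RicciU x) (hB : ∀ y ∈ U, S.Bianchi y) :
    (S.devMat x 1 2 * S.KMat x 0 3 - S.devMat x 1 3 * S.KMat x 0 2 + S.devMat x 2 3 * S.KMat x 0 1)
      - (S.KMat x 0 3 * S.devMat x 1 2 - S.KMat x 0 2 * S.devMat x 1 3
        + S.KMat x 0 1 * S.devMat x 2 3) = 0 := by
  have hdev : ∀ d, S.devMat x 0 d = 0 := by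
    intro d
    ext a b
    simp [devMat, hS.dev_zero₃ hU hx hJ hR]
  have h := hS.commutator_riemannMat_KMat hU hx hJ hB
  simp only [riemannMat_eq, hdev] at h
  rw [← neg_eq_zero, ← h]
  noncomm_ring

theorem IsRegularOn.isSymm_I (hS : S.IsRegularOn U) (hx : x ∈ U) : (S.I x).IsSymm :=
  (hS.symm_E x hx).sub ((hS.symm_aniso x hx).smul _)

/-- The linear system for the deviation from the spatial field equations holds for solutions of
the Jacobi-Ricci-Bianchi system. -/
theorem IsRegularOn.ySystem (hS : S.IsRegularOn U) (hU : IsOpen U) (hx : x ∈ U)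
    (hJ : S.Jacobi x) (hR : S.RicciU x) (hB : ∀ y ∈ U, S.Bianchi y) : S.YSystem x := by
  have hl := hS.dev_antisymm_left hU hx
  have hp := hS.dev_pair_symm hU hx hJ
  have hld := fun a c d => eq_zero_of_antisymm (fun a b => hl a b c d) a
  have hI := fun α β => (hS.isSymm_I hx).apply β α
  have hdev : ∀ c d, S.devMat x c d = !![0, 0, 0, 0;
      0, 0, S.dev 1 2 c d x, S.dev 1 3 c d x;
      0, -S.dev 1 2 c d x, 0, S.dev 2 3 c d x;
      0, -S.dev 1 3 c d x, -S.dev 2 3 c d x, 0] := by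
    intro c d
    ext a b
    simp only [devMat, Matrix.of_apply]
    fin_cases a <;> fin_cases b <;>
      simp [g_eq, hS.dev_zero₁ hU hx hR, hS.dev_zero₂ hx hR, hld, hl 2 1, hl 3 1, hl 3 2]
  obtain ⟨c, hK⟩ := hS.KMat_zero_succ hx
  have h := hS.commutator_devMat_KMat hU hx hJ hR hB
  have hK0 := hK 0
  have hK1 := hK 1
  have hK2 := hK 2
  simp only [Fin.succ_zero_eq_one, Fin.succ_one_eq_two, show (2 : Fin 3).succ = 3 from rfl]
    at hK0 hK1 hK2
  rw [hK0, hK1, hK2, hdev, hdev, hdev, ← Matrix.ext_iff] at h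
  -- The deviation is a rotation. Its commutator with the boost part gives the entries 0α, which
  -- contain I; with the rotation part it gives the entries αβ, which contain J. The terms in `c`
  -- cancel by the pair symmetry of `dev`.
  have h01 := h 0 1
  have h02 := h 0 2
  have h03 := h 0 3
  have h12 := h 1 2
  have h13 := h 1 3
  have h23 := h 2 3
  simp [g_eq, hp 2 3 1 2, hp 2 3 1 3, hp 1 3 1 2, hI 1 0, hI 0 2, hI 2 1]
    at h01 h02 h03 h12 h13 h23
  simp only [YSystem, hS.Y_eq hU hx hJ hR]
  refine ⟨?_, ?_⟩
  · ext i
    fin_cases i <;> simp [Matrix.mulVec, dotProduct, Fin.sum_univ_three] <;> linarith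
  · ext i
    fin_cases i <;> simp [Matrix.mulVec, dotProduct, Fin.sum_univ_three] <;> linarith

/-- At a generic point the linear system only has the trivial solution. -/
theorem IsRegularOn.ySystem_iff_efe (hS : S.IsRegularOn U) (hU : IsOpen U) (hx : x ∈ U)
    (hJ : S.Jacobi x) (hR : S.RicciU x) (hG : Generic S x) : S.YSystem x ↔ S.EFE x := by
  have hIs := hS.isSymm_I hx
  have hYs : ∀ α β, S.Y x α β = S.Y x β α := by
    intro α β
    rw [hS.Y_eq hU hx hJ hR]
    fin_cases α <;> fin_cases β <;> simp
  have hI := fun α β => hIs.apply α β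
  refine ⟨fun hY => ?_, fun hE => ?_⟩
  · obtain ⟨hYI, hYJ⟩ := hY
    -- The first block lists the off-diagonal entries of [I, Y]; the diagonal ones vanish by
    -- symmetry.
    have hIY : Commute (S.I x) (S.Y x) := by
      have h0 := congrFun hYI 0
      have h1 := congrFun hYI 1
      have h2 := congrFun hYI 2
      simp [Matrix.mulVec, dotProduct, Fin.sum_univ_three] at h0 h1 h2
      refine Matrix.ext fun α β => ?_
      simp only [Matrix.mul_apply, Fin.sum_univ_three]
      fin_cases α <;> fin_cases β <;>
        simp [hI 0 1, hI 0 2, hI 1 2, hYs 1 0, hYs 2 0, hYs 2 1] at h0 h1 h2 ⊢ <;> linarith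
    have hHY := hG.nonDegenerate.commute hIs hG.commute hIY
    have hY0 : S.Y x = 0 := by
      -- With [H, Y] = 0 the H terms leave the second block, and the q terms are the components of
      -- (tr Y - Y)q.
      refine hG.nonDegenerate.eq_zero_of_trace_sub_mulVec hIs hG.commute hIY hG.not_parallel ?_
      have h0 := congrFun hYJ 0
      have h1 := congrFun hYJ 1
      have h2 := congrFun hYJ 2
      have hH := fun α β => (hS.symm_H x hx).apply α β
      have hHY' := fun α β => congrFun (congrFun hHY.eq α) β
      have h01 := hHY' 0 1
      have h02 := hHY' 0 2
      have h12 := hHY' 1 2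
      simp only [Matrix.mul_apply, Fin.sum_univ_three, hH 0 1, hH 1 2, hYs 1 0,
        hYs 2 1] at h01 h02 h12
      simp [Matrix.mulVec, dotProduct, Fin.sum_univ_three, Fin.sum_univ_four, J, uUp, extVec_eq,
        eta_zero_right, hH 0 1, hH 0 2, hH 1 2, hYs 2 0] at h0 h1 h2
      ext i
      fin_cases i <;>
        simp [Matrix.mulVec, dotProduct, Fin.sum_univ_three, Matrix.trace_fin_three, hYs 1 0,
          hYs 2 0, hYs 2 1] <;> linarith
    have hYdev := hS.Y_eq hU hx hJ hR
    rw [hY0, ← Matrix.ext_iff] at hYdev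
    have h22 := hYdev 2 2
    have h11 := hYdev 1 1
    have h00 := hYdev 0 0
    simp at h00 h11 h22
    have hl := hS.dev_antisymm_left hU hx
    have hr := hS.dev_antisymm hx
    have hld := fun a c d => eq_zero_of_antisymm (fun a b => hl a b c d) a
    -- The scalar contraction is the only contribution to the 00 equation; the 0α equations hold
    -- without it.
    have htr : ∑ d, g d d * ∑ c, g c c * S.dev c d c d x = 0 := by
      simp [Fin.sum_univ_four, hS.dev_zero₁ hU hx hR, hS.dev_zero₂ hx hR, hld, hl 2 1, hl 3 1,
        hl 3 2, hr _ _ 2 1, hr _ _ 3 1, hr _ _ 3 2, h00, h11, h22]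
    intro a b
    suffices h : S.T a b x - S.einstein a b x = 0 from (sub_eq_zero.mp h).symm
    induction a using Fin.cases with
    | zero => simp [hS.T_sub_einstein hx, htr, hS.dev_zero₂ hx hR]
    | succ α =>
      induction b using Fin.cases with
      | zero => simp [hS.T_sub_einstein hx, htr, hr _ _ _ 0, hS.dev_zero₃ hU hx hJ hR]
      | succ β => exact congrFun (congrFun hY0 α) β
  · have hY0 : S.Y x = 0 := by
      ext α β
      simp [Y, hE α.succ β.succ]
    simp [YSystem, hY0]

end Fields

end JRB

end

theorem theorem2 (U : Set JRB.Pt) (hU : IsOpen U) (S : JRB.Fields) (hS : S.IsRegularOn U) :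
    -- for a generic solution of the JRB-system the field equations hold
    (S.IsJRBSolutionOn U → ∀ x ∈ U, JRB.Generic S x → S.EFE x) ∧
    -- the integrability conditions of the Bianchi equations: a linear system for the `𝓨_αβ`
    (S.IsJRBSolutionOn U → ∀ x ∈ U, S.YSystem x) ∧
    -- in the generic case these conditions are nothing but the field equations
    (∀ x ∈ U, S.Jacobi x → S.RicciU x → JRB.Generic S x → (S.YSystem x ↔ S.EFE x)) := by
  have hY : S.IsJRBSolutionOn U → ∀ x ∈ U, S.YSystem x := fun hsol x hx =>
    hS.ySystem hU hx (hsol x hx).1 (hsol x hx).2.1 fun y hy => (hsol y hy).2.2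
  have hiff : ∀ x ∈ U, S.Jacobi x → S.RicciU x → JRB.Generic S x → (S.YSystem x ↔ S.EFE x) :=
    fun x hx hJ hR hG => hS.ySystem_iff_efe hU hx hJ hR hG
  exact ⟨fun hsol x hx hG => (hiff x hx (hsol x hx).1 (hsol x hx).2.1 hG).mp (hY hsol x hx), hY,
    hiff⟩
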